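/- **Conventions.** Let $E=(E;+,0,1)$ be a pseudo-effect algebra (PEA), i.e. a set with a partial binary operation $+$ and constants $0,1$ such that for all $a,b,c\in E$: (PE1) $a+b$ and $(a+b)+c$ exist iff $b+c$ and $a+(b+c)$ exist, and then $(a+b)+c=a+(b+c)$; (PE2) there are exactly one $d$ and exactly one $e$ with $a+d=e+a=1$ (write $a^\sim=d$, $a^-=e$); (PE3) if $a+b$ exists, there are $d,e$ with $a+b=d+a=b+e$; (PE4) if $a+1$ or $1+a$ exists, then $a=0$. Put $a\le b$ iff $a+c=b$ for some $c$, and let $nc$ be the $n$-fold partial sum of $c$. Isomorphisms of PEAs are bijections that, together with their inverses, preserve $0$, $1$ and existing sums. An *ideal* is a nonempty subset of $E$ that is downward closed and closed under existing sums; a *maximal ideal* is an ideal not containing $1$ that is not properly contained in another such ideal. $E$ satisfies (RDP)$_1$ if whenever $a_1+a_2=b_1+b_2$ in $E$, there are $c_{11},c_{12},c_{21},c_{22}\in E$ with $a_1=c_{11}+c_{12}$, $a_2=c_{21}+c_{22}$, $b_1=c_{11}+c_{21}$, $b_2=c_{12}+c_{22}$ such that for all $x\le c_{12}$ and $y\le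 c_{21}$ both $x+y$ and $y+x$ exist and are equal. A *po-group* is a (not necessarily abelian) group, written additively, with a translation-invariant partial order. It is *directed* if any two elements have a common upper bound, and *torsion-free* if $mg\neq 0$ for all $g\ne 0$ and all nonzero integers $m$. It satisfies (RDP)$_1$ if its positive cone has the property above. An element $u\ge 0$ of a po-group $H$ is a *strong unit* if every $h\in H$ satisfies $h\le mu$ for some integer $m\ge 1$; then $(H,u)$ is a *unital po-group*. For $u\geq 0$ in a po-group $H$, $\Gamma(H,u)=\{x\in H: 0\le x\le u\}$ is the PEA with constants $0,u$ in which $a+b$ is defined iff $a\le u-b$ and is then the group sum. $\mathbb Z\overrightarrow{\times}G$ is the direct product group with the lexicographic order. An *$n$-decomposition* of $E$ is a tuple $(E_0,\dots,E_n)$ of nonempty, pairwise disjoint subsets with union $E$ such that $\{x^-:x\in E_i\}=\{x^\sim:x\in E_i\}=E_{n-i}$ for all $i$, and such that $x\in E_i$, $y\in E_j$ and existence of $x+y$ imply $i+j\le n$ and $x+y\in E_{i+j}$. $E$ is *$n$-perfect* if it has an $n$-decomposition such that $x+y$ exists for all $x\in E_i$, $y\in E_j$ with $i+j<n$, and $E_0$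 is the unique maximal ideal of $E$. $E$ is *strong $n$-perfect* if it is $n$-perfect with such a decomposition $(E_0,\dots,E_n)$, satisfies (RDP)$_1$, and there are a torsion-free unital po-group $(H,u)$ with $E=\Gamma(H,u)$ (up to isomorphism of PEAs) and an element $c\in E_1$ with $nc=u$ and $c+x=x+c$ for all $x\in H$. **Theorem.** Let $E$ be a PEA and $n\ge 1$ an integer. Then $E$ is a strong $n$-perfect PEA if and only if there is a torsion-free directed po-group $G$ such that $\mathbb Z\overrightarrow{\times}G$ satisfies (RDP)$_1$ and $E\cong\Gamma(\mathbb Z\overrightarrow{\times}G,(n,0))$. In that case $G$ is unique up to isomorphism of po-groups, and $G$ satisfies (RDP)$_1$. -/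

import Mathlib

universe u

/-- A pseudo-effect algebra. The partial binary operation is `padd`, with values in `Part E`:
`c ∈ padd a b` says that `a + b` exists and equals `c`. -/
class PseudoEffectAlgebra (E : Type u) extends Zero E, One E where
  /-- the partial addition -/
  padd : E → E → Part E
  /-- (PE1) `a + b` and `(a + b) + c` exist iff `b + c` and `a + (b + c)` exist, and then
  `(a + b) + c = a + (b + c)`. -/
  assoc : ∀ a b c s : E, (∃ t ∈ padd a b, s ∈ padd t c) ↔ (∃ t ∈ padd b c, s ∈ padd a t)
  /-- (PE2), right complement -/
  existsUnique_right : ∀ a : E, ∃! d : E, 1 ∈ padd a d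
  /-- (PE2), left complement -/
  existsUnique_left : ∀ a : E, ∃! e : E, 1 ∈ padd e a
  /-- (PE3) -/
  exists_conj : ∀ a b s : E, s ∈ padd a b → ∃ d e : E, s ∈ padd d a ∧ s ∈ padd b e
  /-- (PE4) -/
  eq_zero : ∀ a : E, (padd a 1).Dom ∨ (padd 1 a).Dom → a = 0

namespace PseudoEffectAlgebra

section Basic

variable {E : Type u} [PseudoEffectAlgebra E]

/-- The order of a pseudo-effect algebra: `a ≤ b` iff `a + c = b` for some `c`. -/
def Le (a b : E) : Prop := ∃ c : E, b ∈ padd a c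

/-- The partial multiple `n a`: `0 a = 0` and `(n + 1) a = n a + a` when this is defined. -/
def pmul : ℕ → E → Part E
  | 0, _ => Part.some 0
  | n + 1, a => (pmul n a).bind fun t => padd t a

/-- `A⁻ = {a⁻ | a ∈ A}`, where `a⁻` is the element with `a⁻ + a = 1`. -/
def leftCompl (A : Set E) : Set E := {y | ∃ x ∈ A, 1 ∈ padd y x}

/-- `A^∼ = {a^∼ | a ∈ A}`, where `a^∼` is the element with `a + a^∼ = 1`. -/
def rightCompl (A : Set E) : Set E := {y | ∃ x ∈ A, 1 ∈ padd x y}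

/-- Ideals: nonempty, downward closed, closed under existing sums. -/
structure IsIdeal (I : Set E) : Prop where
  nonempty : I.Nonempty
  down : ∀ a i : E, i ∈ I → Le a i → a ∈ I
  add : ∀ i j s : E, i ∈ I → j ∈ I → s ∈ padd i j → s ∈ I

/-- Maximal ideals: proper (`1 ∉ I`) and not properly included in a proper ideal. -/
structure IsMaximalIdeal (I : Set E) : Prop where
  isIdeal : IsIdeal I
  proper : (1 : E) ∉ I
  maximal : ∀ J : Set E, IsIdeal J → (1 : E) ∉ J → I ⊆ J → J = I

/-- `(D 0, …, D n)` is an `n`-decomposition of `E`. -/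
structure IsDecomposition (n : ℕ) (D : Fin (n + 1) → Set E) : Prop where
  nonempty : ∀ i, (D i).Nonempty
  disjoint : ∀ i j, i ≠ j → D i ∩ D j = ∅
  cover : ⋃ i, D i = Set.univ
  /-- note that `i.rev` is `n - i` -/
  leftCompl_eq : ∀ i, leftCompl (D i) = D i.rev
  rightCompl_eq : ∀ i, rightCompl (D i) = D i.rev
  /-- if `x ∈ D i`, `y ∈ D j` and `x + y` exists then `i + j ≤ n` and `x + y ∈ D (i + j)` -/
  add_mem : ∀ (i j : Fin (n + 1)) (x y s : E), x ∈ D i → y ∈ D j → s ∈ padd x y →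
    ∃ k : Fin (n + 1), (k : ℕ) = (i : ℕ) + (j : ℕ) ∧ s ∈ D k

/-- The `n`-decomposition `D` makes `E` an `n`-perfect pseudo-effect algebra. -/
structure IsPerfectDecomposition (n : ℕ) (D : Fin (n + 1) → Set E) : Prop where
  isDecomposition : IsDecomposition n D
  exists_add : ∀ i j : Fin (n + 1), (i : ℕ) + (j : ℕ) < n →
    ∀ x ∈ D i, ∀ y ∈ D j, (padd x y).Dom
  isMaximal : IsMaximalIdeal (D 0)
  unique : ∀ I : Set E, IsMaximalIdeal I → I = D 0

variable (E) in
/-- The Riesz decomposition property (RDP)₁ of a pseudo-effect algebra. -/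
def RDP1 : Prop :=
  ∀ a₁ a₂ b₁ b₂ s : E, s ∈ padd a₁ a₂ → s ∈ padd b₁ b₂ →
    ∃ c₁₁ c₁₂ c₂₁ c₂₂ : E,
      a₁ ∈ padd c₁₁ c₁₂ ∧ a₂ ∈ padd c₂₁ c₂₂ ∧ b₁ ∈ padd c₁₁ c₂₁ ∧ b₂ ∈ padd c₁₂ c₂₂ ∧
      ∀ x y : E, Le x c₁₂ → Le y c₂₁ → ∃ t : E, t ∈ padd x y ∧ t ∈ padd y x

end Basic

/-- Isomorphisms of pseudo-effect algebras: bijections that, together with their inverses,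
preserve `0`, `1` and existing sums. -/
structure Iso (E : Type*) (F : Type*) [PseudoEffectAlgebra E] [PseudoEffectAlgebra F]
    extends E ≃ F where
  map_zero : toEquiv 0 = 0
  map_one : toEquiv 1 = 1
  map_padd : ∀ a b s : E, s ∈ padd a b ↔ toEquiv s ∈ padd (toEquiv a) (toEquiv b)

end PseudoEffectAlgebra

/-! ### Partially ordered groups

A (not necessarily commutative) po-group is an additive group with a partial order that is
invariant under left and right translations:
`[AddGroup G] [PartialOrder G] [AddLeftMono G] [AddRightMono G]`. -/

namespace PoGroup

/-- Torsion-free groups: `m g ≠ 0` for all `g ≠ 0` and all nonzero integers `m`. (For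
non-commutative groups this is weaker than Mathlib's `IsAddTorsionFree`, which is about
uniqueness of roots.) -/
def TorsionFree (G : Type*) [AddGroup G] : Prop :=
  ∀ (g : G) (m : ℤ), g ≠ 0 → m ≠ 0 → m • g ≠ 0

/-- Directed po-groups. -/
def Directed (G : Type*) [PartialOrder G] : Prop :=
  ∀ a b : G, ∃ c : G, a ≤ c ∧ b ≤ c

/-- `u` is a strong unit of the po-group `G`. -/
def IsStrongUnit {G : Type*} [AddGroup G] [PartialOrder G] (u : G) : Prop :=
  0 ≤ u ∧ ∀ g : G, ∃ m : ℕ, 1 ≤ m ∧ g ≤ m • u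

/-- The Riesz decomposition property (RDP)₁ of a po-group, i.e. of its positive cone. -/
def RDP1 (G : Type*) [AddGroup G] [PartialOrder G] : Prop :=
  ∀ a₁ a₂ b₁ b₂ : G, 0 ≤ a₁ → 0 ≤ a₂ → 0 ≤ b₁ → 0 ≤ b₂ → a₁ + a₂ = b₁ + b₂ →
    ∃ c₁₁ c₁₂ c₂₁ c₂₂ : G, 0 ≤ c₁₁ ∧ 0 ≤ c₁₂ ∧ 0 ≤ c₂₁ ∧ 0 ≤ c₂₂ ∧
      a₁ = c₁₁ + c₁₂ ∧ a₂ = c₂₁ + c₂₂ ∧ b₁ = c₁₁ + c₂₁ ∧ b₂ = c₁₂ + c₂₂ ∧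
      ∀ x y : G, 0 ≤ x → x ≤ c₁₂ → 0 ≤ y → y ≤ c₂₁ → x + y = y + x

section Gamma

variable {G : Type*} [AddGroup G] [PartialOrder G]

/-- The interval `Γ(G, u) = {x | 0 ≤ x ≤ u}` of a po-group `G`, for `0 ≤ u`. -/
@[ext]
structure Gamma (u : G) (hu : 0 ≤ u) where
  /-- the underlying element of the group -/
  val : G
  nonneg : 0 ≤ val
  le_unit : val ≤ u

variable [AddLeftMono G] [AddRightMono G]

/-- The pseudo-effect algebra `Γ(G, u)`: `a + b` is defined iff `a ≤ u - b`, and is then the sum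
in the group. -/
instance Gamma.instPEA (u : G) (hu : 0 ≤ u) : PseudoEffectAlgebra (Gamma u hu) where
  zero := ⟨0, le_rfl, hu⟩
  one := ⟨u, hu, le_rfl⟩
  padd a b := ⟨a.val ≤ u - b.val, fun h => ⟨a.val + b.val, add_nonneg a.nonneg b.nonneg,
    le_sub_iff_add_le.1 h⟩⟩
  assoc := by
    rintro ⟨a, ha, ha'⟩ ⟨b, hb, hb'⟩ ⟨c, hc, hc'⟩ ⟨s, hs, hs'⟩
    constructor
    · rintro ⟨t, ⟨_, rfl⟩, ⟨h2, h3⟩⟩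
      have h2' : a + b + c ≤ u := le_sub_iff_add_le.1 h2
      have h4 : a + (b + c) ≤ u := by rwa [← add_assoc]
      have h5 : b + c ≤ u := le_trans (le_add_of_nonneg_left ha) h4
      refine ⟨⟨b + c, add_nonneg hb hc, h5⟩, ⟨le_sub_iff_add_le.2 h5, rfl⟩,
        ⟨le_sub_iff_add_le.2 h4, ?_⟩⟩
      rw [← h3]
      exact Gamma.ext (add_assoc a b c).symm
    · rintro ⟨t, ⟨_, rfl⟩, ⟨h2, h3⟩⟩
      have h2' : a + (b + c) ≤ u := le_sub_iff_add_le.1 h2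
      have h4 : a + b + c ≤ u := by rwa [add_assoc]
      have h5 : a + b ≤ u := le_trans (le_add_of_nonneg_right hc) h4
      refine ⟨⟨a + b, add_nonneg ha hb, h5⟩, ⟨le_sub_iff_add_le.2 h5, rfl⟩,
        ⟨le_sub_iff_add_le.2 h4, ?_⟩⟩
      rw [← h3]
      exact Gamma.ext (add_assoc a b c)
  existsUnique_right := by
    rintro ⟨a, ha, ha'⟩
    refine ⟨⟨-a + u, ?_, ?_⟩, ⟨?_, ?_⟩, ?_⟩
    · rw [← neg_add_cancel a]; exact add_le_add_right ha' _
    · exact add_le_of_nonpos_left (neg_nonpos.2 ha)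
    · apply le_sub_iff_add_le.2; simp
    · exact Gamma.ext (by simp; rfl)
    · rintro ⟨d, hd, hd'⟩ ⟨_, h⟩
      have h' : a + d = u := congrArg Gamma.val h
      exact Gamma.ext (by simp [← h'])
  existsUnique_left := by
    rintro ⟨a, ha, ha'⟩
    refine ⟨⟨u - a, sub_nonneg.2 ha', sub_le_self u ha⟩, ⟨le_rfl, ?_⟩, ?_⟩
    · exact Gamma.ext (sub_add_cancel u a)
    · rintro ⟨d, hd, hd'⟩ ⟨_, h⟩
      have h' : d + a = u := congrArg Gamma.val h
      exact Gamma.ext (by simp [← h'])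
  exists_conj := by
    rintro ⟨a, ha, ha'⟩ ⟨b, hb, hb'⟩ _ ⟨h, rfl⟩
    have h' : a + b ≤ u := le_sub_iff_add_le.1 h
    have h1 : 0 ≤ a + b - a := by
      rw [sub_nonneg]; exact le_add_of_nonneg_right hb
    have h2 : 0 ≤ -b + (a + b) := by
      rw [← neg_add_cancel b]; exact add_le_add_right (le_add_of_nonneg_left ha) _
    refine ⟨⟨a + b - a, h1, (sub_le_self _ ha).trans h'⟩,
      ⟨-b + (a + b), h2, (add_le_of_nonpos_left (neg_nonpos.2 hb)).trans h'⟩,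
      ⟨?_, ?_⟩, ⟨?_, ?_⟩⟩
    · apply le_sub_iff_add_le.2; simpa using h'
    · exact Gamma.ext (by simp)
    · apply le_sub_iff_add_le.2; simpa using h'
    · exact Gamma.ext (by simp)
  eq_zero := by
    rintro ⟨a, ha, ha'⟩ (h | h)
    · have h' : a + u ≤ u := le_sub_iff_add_le.1 h
      exact Gamma.ext (le_antisymm (show a ≤ 0 by simpa using h') ha)
    · have h' : u + a ≤ u := le_sub_iff_add_le.1 h
      exact Gamma.ext (le_antisymm (show a ≤ 0 by simpa using h') ha)

end Gamma

section Lex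

variable {G : Type*} [AddGroup G] [PartialOrder G]

/-! The lexicographic product of `ℤ` and `G` is Mathlib's `ℤ ×ₗ G`. -/

instance lex_addLeftMono [AddLeftMono G] : AddLeftMono (ℤ ×ₗ G) where
  elim := by
    intro c a b h
    rw [Prod.Lex.le_iff] at h ⊢
    rcases h with h | ⟨h1, h2⟩
    · exact Or.inl (add_lt_add_right h (ofLex c).1)
    · exact Or.inr ⟨congrArg ((ofLex c).1 + ·) h1, add_le_add_right h2 (ofLex c).2⟩

instance lex_addRightMono [AddRightMono G] : AddRightMono (ℤ ×ₗ G) where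
  elim := by
    intro c a b h
    rw [Prod.Lex.le_iff] at h ⊢
    rcases h with h | ⟨h1, h2⟩
    · exact Or.inl (add_lt_add_left h (ofLex c).1)
    · exact Or.inr ⟨congrArg (· + (ofLex c).1) h1, add_le_add_left h2 (ofLex c).2⟩

/-- The element `(n, 0)` of the lexicographic product of `ℤ` and `G`. -/
def lexUnit (G : Type*) [AddGroup G] (n : ℕ) : ℤ ×ₗ G := toLex ((n : ℤ), (0 : G))

theorem lexUnit_nonneg (n : ℕ) : 0 ≤ lexUnit G n := by
  rw [Prod.Lex.le_iff]
  rcases Nat.eq_zero_or_pos n with h | h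
  · exact Or.inr ⟨by subst h; rfl, le_rfl⟩
  · exact Or.inl (Int.natCast_pos.2 h)

end Lex

end PoGroup

namespace PseudoEffectAlgebra

open PoGroup

/-- Strong `n`-perfect pseudo-effect algebras: `E` is `n`-perfect with (RDP)₁, it is `Γ(H, u)` for
a torsion-free unital po-group `(H, u)` (through the isomorphism `f`), and some `c ∈ E₁` satisfies
`n c = 1` and commutes in `H` with all elements of `H`. -/
def IsStrongPerfect (n : ℕ) (E : Type u) [PseudoEffectAlgebra E] : Prop :=
  RDP1 E ∧
  ∃ D : Fin (n + 1) → Set E, IsPerfectDecomposition n D ∧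
  ∃ (H : Type u) (_ : AddGroup H) (_ : PartialOrder H) (_ : AddLeftMono H) (_ : AddRightMono H)
    (u : H) (hu : IsStrongUnit u) (f : Iso E (Gamma u hu.1)),
    TorsionFree H ∧
    ∃ (k : Fin (n + 1)) (c : E), (k : ℕ) = 1 ∧ c ∈ D k ∧ 1 ∈ pmul n c ∧
      ∀ x : H, x + (f.toEquiv c).val = (f.toEquiv c).val + x

/-- `G` is a torsion-free directed po-group such that `ℤ ×ₗ G` satisfies (RDP)₁ and `E` is
isomorphic to `Γ(ℤ ×ₗ G, (n, 0))`. -/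
structure IsRepresentedBy (n : ℕ) (E : Type u) [PseudoEffectAlgebra E] (G : Type u) [AddGroup G]
    [PartialOrder G] [AddLeftMono G] [AddRightMono G] : Prop where
  torsionFree : TorsionFree G
  directed : Directed G
  rdp1_lex : PoGroup.RDP1 (ℤ ×ₗ G)
  iso : Nonempty (Iso E (Gamma (lexUnit G n) (lexUnit_nonneg n)))

end PseudoEffectAlgebra

/-! From a strong `n`-perfect `E = Γ(H, u)` the group `G` is recovered inside `H`, as the subgroup
generated by the part `E₀`, the "infinitesimals". Levels add, an element of smaller level lies below
any element of larger level, and (PE3) lets differences of level-`0` elements be added, so these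
differences form a directed subgroup. The main point is that every `x` of level `k` equals `k c + g`
with `g` infinitesimal. For `k = 1`, maximality of `E₀` forces the ideal generated by `x` to contain
`1`, hence `c`. By (RDP)₁ this makes `c` a finite sum of elements below `x`; counting levels,
exactly one summand has level `1`, so `c` and `x` agree up to infinitesimals, and centrality of `c`
collects the errors on one side. Higher levels follow by subtracting `c`. Then `(k, g) ↦ k c + g` is
an injective homomorphism matching the lexicographic interval with `[0, u]`. It need not match the
orders elsewhere, so (RDP)₁ for `ℤ ×ₗ G` is derived from (RDP)₁ for `G`, which comes from `E`.

Conversely, the first coordinate gives the decomposition of the lexicographic interval, and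
directedness of `G` makes any ideal that meets a positive level improper.

For uniqueness, the unique maximal ideal is intrinsic to `E` and is the positive cone of `G`; a
directed po-group is determined by its cone. -/

namespace PoGroup

/-! ### Lexicographic products and the Riesz decomposition property. -/

section LexProduct

variable {G : Type*} [AddGroup G] [PartialOrder G]

theorem toLex_nonneg_iff {k : ℤ} {g : G} :
    0 ≤ (toLex (k, g) : ℤ ×ₗ G) ↔ 0 < k ∨ k = 0 ∧ 0 ≤ g := by
  rw [Prod.Lex.le_iff]
  exact or_congr Iff.rfl (and_congr_left fun _ => eq_comm)

theorem toLex_le_lexUnit_iff {k : ℤ} {g : G} {n : ℕ} :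
    (toLex (k, g) : ℤ ×ₗ G) ≤ lexUnit G n ↔ k < n ∨ k = n ∧ g ≤ 0 := by
  rw [Prod.Lex.le_iff]
  rfl

omit [PartialOrder G] in
theorem toLex_add_toLex (k l : ℤ) (g h : G) :
    (toLex (k, g) + toLex (l, h) : ℤ ×ₗ G) = toLex (k + l, g + h) := rfl

theorem Directed.exists_le_le [AddLeftMono G] [AddRightMono G] (hG : Directed G) (a b : G) :
    ∃ c : G, c ≤ a ∧ c ≤ b := by
  obtain ⟨c, h1, h2⟩ := hG (-a) (-b)
  exact ⟨-c, neg_le.1 h1, neg_le.1 h2⟩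

variable [AddLeftMono G] [AddRightMono G]

/-- For a directed po-group `G`, (RDP)₁ passes to the lexicographic product `ℤ ×ₗ G`. -/
theorem RDP1.lex (hG : RDP1 G) (hd : Directed G) : RDP1 (ℤ ×ₗ G) := by
  intro a₁ a₂ b₁ b₂ ha₁ ha₂ hb₁ hb₂ h
  obtain ⟨⟨i₁, p⟩, rfl⟩ := toLex.surjective a₁
  obtain ⟨⟨i₂, q⟩, rfl⟩ := toLex.surjective a₂
  obtain ⟨⟨j₁, r⟩, rfl⟩ := toLex.surjective b₁
  obtain ⟨⟨j₂, s⟩, rfl⟩ := toLex.surjective b₂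
  have h' := toLex.injective h
  obtain ⟨h1, h2⟩ := Prod.ext_iff.1 h'
  change i₁ + i₂ = j₁ + j₂ at h1
  change p + q = r + s at h2
  rcases lt_trichotomy i₁ j₁ with hlt | heq | hgt
  -- With different levels, `a₁` lies strictly below `b₁`, so one off-diagonal entry can be `0`,
  -- which makes the commutation condition trivial.
  · refine ⟨toLex (i₁, p), 0, -toLex (i₁, p) + toLex (j₁, r), toLex (j₂, s), ha₁, le_rfl, ?_, hb₂,
      by simp, ?_, by simp, by simp, ?_⟩
    · exact toLex_nonneg_iff.2 (Or.inl (show 0 < -i₁ + j₁ by omega))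
    · rw [add_assoc, ← h, neg_add_cancel_left]
    · intro x y hx hx' _ _
      rw [le_antisymm hx' hx]; simp
  · obtain rfl := heq
    obtain rfl : i₂ = j₂ := by omega
    -- At equal levels, the second coordinates may fail to be positive. Subtracting common lower
    -- bounds moves the problem into the cone of `G`. At level `0` the bound must be `0`, so that
    -- the corner entries stay positive when it is added back.
    have lower : ∀ (i : ℤ) (p r : G), 0 ≤ (toLex (i, p) : ℤ ×ₗ G) →
        0 ≤ (toLex (i, r) : ℤ ×ₗ G) → ∃ w, w ≤ p ∧ w ≤ r ∧ 0 ≤ (toLex (i, w) : ℤ ×ₗ G) := by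
      intro i p r hp hr
      rw [toLex_nonneg_iff] at hp hr
      by_cases hi : 0 < i
      · obtain ⟨w, h1, h2⟩ := hd.exists_le_le p r
        exact ⟨w, h1, h2, toLex_nonneg_iff.2 (Or.inl hi)⟩
      · obtain ⟨h0, hp⟩ := hp.resolve_left hi
        obtain ⟨-, hr⟩ := hr.resolve_left hi
        exact ⟨0, hp, hr, toLex_nonneg_iff.2 (Or.inr ⟨h0, le_rfl⟩)⟩
    obtain ⟨w, hwp, hwr, hw⟩ := lower i₁ p r ha₁ hb₁
    obtain ⟨z, hzq, hzs, hz⟩ := lower i₂ q s ha₂ hb₂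
    have nn : ∀ {a b : G}, a ≤ b → 0 ≤ -a + b := fun {a b} hab => by
      rw [← neg_add_cancel a]; exact add_le_add_right hab _
    obtain ⟨c₁₁, c₁₂, c₂₁, c₂₂, n₁₁, n₁₂, n₂₁, n₂₂, e1, e2, e3, e4, hc⟩ :=
      hG (-w + p) (q - z) (-w + r) (s - z) (nn hwp) (sub_nonneg.2 hzq) (nn hwr)
        (sub_nonneg.2 hzs) (by
          have : -w + (p + q) - z = -w + (r + s) - z := by rw [h2]
          simpa [sub_eq_add_neg, add_assoc] using this)
    rw [neg_add_eq_iff_eq_add] at e1 e3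
    rw [sub_eq_iff_eq_add] at e2 e4
    have shift : ∀ (i : ℤ) (w g : G), 0 ≤ (toLex (i, w) : ℤ ×ₗ G) → 0 ≤ g →
        0 ≤ (toLex (i, w + g) : ℤ ×ₗ G) ∧ 0 ≤ (toLex (i, g + w) : ℤ ×ₗ G) := by
      intro i w g hw hg
      simp only [toLex_nonneg_iff] at hw ⊢
      rcases hw with hi | ⟨hi, hw⟩
      · exact ⟨Or.inl hi, Or.inl hi⟩
      · exact ⟨Or.inr ⟨hi, add_nonneg hw hg⟩, Or.inr ⟨hi, add_nonneg hg hw⟩⟩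
    refine ⟨toLex (i₁, w + c₁₁), toLex (0, c₁₂), toLex (0, c₂₁), toLex (i₂, c₂₂ + z),
      (shift _ _ _ hw n₁₁).1, toLex_nonneg_iff.2 (Or.inr ⟨rfl, n₁₂⟩),
      toLex_nonneg_iff.2 (Or.inr ⟨rfl, n₂₁⟩), (shift _ _ _ hz n₂₂).2, ?_, ?_, ?_, ?_, ?_⟩
    · rw [toLex_add_toLex, e1, add_zero, add_assoc]
    · rw [toLex_add_toLex, e2, zero_add, add_assoc]
    · rw [toLex_add_toLex, e3, add_zero, add_assoc]
    · rw [toLex_add_toLex, e4, zero_add, add_assoc]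
    · have level : ∀ (x : ℤ ×ₗ G) (c : G), 0 ≤ x → x ≤ toLex (0, c) →
          ∃ g, 0 ≤ g ∧ g ≤ c ∧ x = toLex (0, g) := by
        intro x c hx hxc
        obtain ⟨⟨k, g⟩, rfl⟩ := toLex.surjective x
        rw [toLex_nonneg_iff] at hx
        rw [Prod.Lex.toLex_le_toLex] at hxc
        dsimp only at hxc
        obtain rfl : k = 0 := by omega
        refine ⟨g, ?_, ?_, rfl⟩
        · simpa using hx
        · simpa using hxc
      intro x y hx hx' hy hy'
      obtain ⟨g, hg, hg', rfl⟩ := level x _ hx hx'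
      obtain ⟨k, hk, hk', rfl⟩ := level y _ hy hy'
      rw [toLex_add_toLex, toLex_add_toLex, hc g k hg hg' hk hk']
  · refine ⟨toLex (j₁, r), -toLex (j₁, r) + toLex (i₁, p), 0, toLex (i₂, q), hb₁, ?_, le_rfl, ha₂,
      by simp, by simp, by simp, ?_, ?_⟩
    · exact toLex_nonneg_iff.2 (Or.inl (show 0 < -j₁ + i₁ by omega))
    · rw [add_assoc, h, neg_add_cancel_left]
    · intro x y _ _ hy hy'
      rw [le_antisymm hy' hy]; simp

omit [AddLeftMono G] [AddRightMono G] in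
/-- (RDP)₁ passes from the lexicographic product `ℤ ×ₗ G` to `G`. -/
theorem RDP1.of_lex (h : RDP1 (ℤ ×ₗ G)) : RDP1 G := by
  intro a₁ a₂ b₁ b₂ ha₁ ha₂ hb₁ hb₂ hab
  have nn : ∀ {g : G}, 0 ≤ g → 0 ≤ (toLex (0, g) : ℤ ×ₗ G) := fun hg =>
    toLex_nonneg_iff.2 (Or.inr ⟨rfl, hg⟩)
  obtain ⟨c₁₁, c₁₂, c₂₁, c₂₂, n₁₁, n₁₂, n₂₁, n₂₂, e1, e2, e3, e4, hc⟩ :=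
    h (toLex (0, a₁)) (toLex (0, a₂)) (toLex (0, b₁)) (toLex (0, b₂)) (nn ha₁) (nn ha₂) (nn hb₁)
      (nn hb₂) (by rw [toLex_add_toLex, toLex_add_toLex, hab])
  obtain ⟨⟨k₁₁, c₁₁⟩, rfl⟩ := toLex.surjective c₁₁
  obtain ⟨⟨k₁₂, c₁₂⟩, rfl⟩ := toLex.surjective c₁₂
  obtain ⟨⟨k₂₁, c₂₁⟩, rfl⟩ := toLex.surjective c₂₁
  obtain ⟨⟨k₂₂, c₂₂⟩, rfl⟩ := toLex.surjective c₂₂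
  -- The first coordinates of the four entries are nonnegative with sums `0`, so they all vanish.
  simp only [toLex_nonneg_iff, toLex_add_toLex, EmbeddingLike.apply_eq_iff_eq, Prod.mk.injEq]
    at n₁₁ n₁₂ n₂₁ n₂₂ e1 e2 e3 e4
  obtain rfl : k₁₁ = 0 := by omega
  obtain rfl : k₁₂ = 0 := by omega
  obtain rfl : k₂₁ = 0 := by omega
  obtain rfl : k₂₂ = 0 := by omega
  simp only [lt_irrefl, true_and, false_or] at n₁₁ n₁₂ n₂₁ n₂₂
  refine ⟨c₁₁, c₁₂, c₂₁, c₂₂, n₁₁, n₁₂, n₂₁, n₂₂, e1.2, e2.2, e3.2, e4.2, fun x y hx hx' hy hy' => ?_⟩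
  have := hc (toLex (0, x)) (toLex (0, y)) (nn hx)
    (Prod.Lex.toLex_le_toLex.2 (Or.inr ⟨rfl, hx'⟩)) (nn hy)
    (Prod.Lex.toLex_le_toLex.2 (Or.inr ⟨rfl, hy'⟩))
  exact congrArg (fun z => (ofLex z).2) this

omit [PartialOrder G] [AddLeftMono G] [AddRightMono G] in
theorem nsmul_toLex (m : ℕ) (k : ℤ) (g : G) :
    (m • toLex (k, g) : ℤ ×ₗ G) = toLex (m • k, m • g) := rfl

omit [PartialOrder G] [AddLeftMono G] [AddRightMono G] in
theorem TorsionFree.lex (hG : TorsionFree G) : TorsionFree (ℤ ×ₗ G) := by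
  intro x m hx hm h
  obtain ⟨⟨k, g⟩, rfl⟩ := toLex.surjective x
  have h' : (m • k, m • g) = (0, 0) := toLex.injective h
  rw [Prod.mk.injEq, smul_eq_mul, mul_eq_zero, or_iff_right hm] at h'
  obtain ⟨rfl, h2⟩ := h'
  refine hG g m ?_ hm h2
  rintro rfl
  exact hx rfl

omit [AddLeftMono G] [AddRightMono G] in
theorem isStrongUnit_lexUnit {n : ℕ} (hn : 1 ≤ n) : IsStrongUnit (lexUnit G n) := by
  refine ⟨lexUnit_nonneg n, fun x => ?_⟩
  obtain ⟨⟨k, g⟩, rfl⟩ := toLex.surjective x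
  -- The extra `1` makes the inequality strict in the first coordinate, so `g` plays no role.
  refine ⟨k.toNat + 1, by omega, ?_⟩
  rw [lexUnit, nsmul_toLex, Prod.Lex.toLex_le_toLex]
  left
  have h1 : (1 : ℤ) ≤ n := by exact_mod_cast hn
  have h2 := Int.self_le_toNat k
  simp only [nsmul_eq_mul]
  push_cast
  nlinarith

end LexProduct

/-! ### Directed po-groups are determined by their positive cones. -/

section Extension

variable {G G' : Type*} [AddGroup G] [PartialOrder G] [AddLeftMono G] [AddRightMono G]
  [AddGroup G'] [PartialOrder G'] [AddLeftMono G'] [AddRightMono G']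

omit [AddRightMono G] [PartialOrder G'] [AddLeftMono G'] [AddRightMono G'] in
/-- A map that is additive on the positive cone of a directed po-group extends to a group
homomorphism. -/
theorem Directed.exists_addMonoidHom (hG : Directed G) (φ : G → G')
    (hφ : ∀ a b, 0 ≤ a → 0 ≤ b → φ (a + b) = φ a + φ b) :
    ∃ F : G →+ G', ∀ a, 0 ≤ a → F a = φ a := by
  have wd : ∀ a b a' b', 0 ≤ a → 0 ≤ b → 0 ≤ a' → 0 ≤ b' → a - b = a' - b' →
      φ a - φ b = φ a' - φ b' := by
    intro a b a' b' ha hb ha' hb' h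
    -- Adding positive elements on the right brings both subtrahends to the common value `z`; in a
    -- noncommutative group the two differences can then be compared.
    obtain ⟨z, hz, hz'⟩ := hG b b'
    have hy : 0 ≤ -b + z := by rw [← neg_add_cancel b]; exact add_le_add_right hz _
    have hy' : 0 ≤ -b' + z := by rw [← neg_add_cancel b']; exact add_le_add_right hz' _
    have e1 : a + (-b + z) = a' + (-b' + z) := by
      simp only [← add_assoc, ← sub_eq_add_neg, h]
    have e2 : b + (-b + z) = b' + (-b' + z) := by simp
    have e1' := congrArg φ e1
    have e2' := congrArg φ e2
    rw [hφ _ _ ha hy, hφ _ _ ha' hy'] at e1'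
    rw [hφ _ _ hb hy, hφ _ _ hb' hy'] at e2'
    calc φ a - φ b = φ a + φ (-b + z) - (φ b + φ (-b + z)) := by simp
      _ = φ a' + φ (-b' + z) - (φ b' + φ (-b' + z)) := by rw [e1', e2']
      _ = φ a' - φ b' := by simp
  have ex : ∀ g : G, ∃ b : G, 0 ≤ b ∧ 0 ≤ g + b := fun g => by
    obtain ⟨b, h1, h2⟩ := hG 0 (-g)
    refine ⟨b, h1, ?_⟩
    rw [← add_neg_cancel g]; exact add_le_add_right h2 _
  choose b hb hgb using ex
  have key : ∀ a c, 0 ≤ a → 0 ≤ c → φ (a - c + b (a - c)) - φ (b (a - c)) = φ a - φ c :=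
    fun a c ha hc => wd _ _ _ _ (hgb _) (hb _) ha hc (by simp)
  have φ0 : φ 0 = 0 := by simpa using hφ 0 0 le_rfl le_rfl
  refine ⟨AddMonoidHom.mk' (fun g => φ (g + b g) - φ (b g)) ?_, ?_⟩
  · intro g h
    obtain ⟨d, hd1, hd2⟩ := hG (b g) (b h)
    -- The element `m'` allows `g = (g + m') - m'` and `h = m' - (-h + m')` with the same middle
    -- term, so that the sum telescopes without commutativity.
    obtain ⟨m, hm1, hm2⟩ := hG (-g) h
    obtain ⟨m', hm3, hm0⟩ := hG m 0
    have h1 : 0 ≤ g + m' := by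
      rw [← add_neg_cancel g]; exact add_le_add_right (hm1.trans hm3) _
    have h2 : 0 ≤ -h + m' := by
      rw [← neg_add_cancel h]; exact add_le_add_right (hm2.trans hm3) _
    have k1 := key (g + m') m' h1 hm0
    have k2 := key m' (-h + m') hm0 h2
    have k3 := key (g + m') (-h + m') h1 h2
    have s1 : g + m' - m' = g := by simp
    have s2 : m' - (-h + m') = h := by simp [sub_eq_add_neg]
    have s3 : g + m' - (-h + m') = g + h := by simp [sub_eq_add_neg, add_assoc]
    rw [s1] at k1
    rw [s2] at k2
    rw [s3] at k3
    rw [k1, k2, k3, sub_add_sub_cancel]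
  · intro a ha
    have := key a 0 ha le_rfl
    rw [sub_zero, φ0, sub_zero] at this
    exact this

/-- Directed po-groups with isomorphic positive cones are isomorphic. -/
theorem Directed.nonempty_orderAddMonoidIso (hG : Directed G) (hG' : Directed G') (φ : G → G')
    (ψ : G' → G) (hφ : ∀ a b, 0 ≤ a → 0 ≤ b → φ (a + b) = φ a + φ b)
    (hψ : ∀ a b, 0 ≤ a → 0 ≤ b → ψ (a + b) = ψ a + ψ b)
    (hφ0 : ∀ a, 0 ≤ a → 0 ≤ φ a) (hψ0 : ∀ a, 0 ≤ a → 0 ≤ ψ a)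
    (hψφ : ∀ a, 0 ≤ a → ψ (φ a) = a) (hφψ : ∀ a, 0 ≤ a → φ (ψ a) = a) :
    Nonempty (G ≃+o G') := by
  obtain ⟨F, hF⟩ := hG.exists_addMonoidHom φ hφ
  obtain ⟨K, hK⟩ := hG'.exists_addMonoidHom ψ hψ
  have inv1 : ∀ g, K (F g) = g := by
    intro g
    obtain ⟨b, h1, h2⟩ := hG 0 (-g)
    have h3 : 0 ≤ g + b := by rw [← add_neg_cancel g]; exact add_le_add_right h2 _
    have pos : ∀ a, 0 ≤ a → K (F a) = a := fun a ha => by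
      rw [hF a ha, hK _ (hφ0 a ha), hψφ a ha]
    have := pos _ h3
    rwa [map_add, map_add, pos b h1, add_left_inj] at this
  have inv2 : ∀ g, F (K g) = g := by
    intro g
    obtain ⟨b, h1, h2⟩ := hG' 0 (-g)
    have h3 : 0 ≤ g + b := by rw [← add_neg_cancel g]; exact add_le_add_right h2 _
    have pos : ∀ a, 0 ≤ a → F (K a) = a := fun a ha => by
      rw [hK a ha, hF _ (hψ0 a ha), hφψ a ha]
    have := pos _ h3
    rwa [map_add, map_add, pos b h1, add_left_inj] at this
  have mono1 : ∀ a b, a ≤ b → F a ≤ F b := fun a b h => by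
    rw [← sub_nonneg, ← map_sub, hF _ (sub_nonneg.2 h)]
    exact hφ0 _ (sub_nonneg.2 h)
  have mono2 : ∀ a b, a ≤ b → K a ≤ K b := fun a b h => by
    rw [← sub_nonneg, ← map_sub, hK _ (sub_nonneg.2 h)]
    exact hψ0 _ (sub_nonneg.2 h)
  exact ⟨⟨⟨⟨F, K, inv1, inv2⟩, map_add F⟩, fun {a b} =>
    ⟨fun h => by simpa only [inv1] using mono2 _ _ h, mono1 a b⟩⟩⟩

end Extension

end PoGroup

namespace PseudoEffectAlgebra

open PoGroup

/-! ### Calculating in `E` with values in the ambient group. -/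

namespace Iso

section Value

variable {E : Type*} [PseudoEffectAlgebra E] {H : Type*} [AddGroup H] [PartialOrder H]
  [AddLeftMono H] [AddRightMono H] {u : H} {hu : 0 ≤ u} (f : Iso E (Gamma u hu))

/-- The element of `H` represented by an element of `E ≅ Γ(H, u)`. -/
def value (x : E) : H := (f.toEquiv x).val

theorem value_injective : Function.Injective f.value := fun _ _ h =>
  f.toEquiv.injective (Gamma.ext h)

theorem value_nonneg (x : E) : 0 ≤ f.value x := (f.toEquiv x).nonneg

theorem value_le (x : E) : f.value x ≤ u := (f.toEquiv x).le_unit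

theorem exists_value {h : H} (h0 : 0 ≤ h) (h1 : h ≤ u) : ∃ x, f.value x = h :=
  ⟨f.toEquiv.symm ⟨h, h0, h1⟩, by simp [value]⟩

theorem mem_padd_iff {x y s : E} : s ∈ padd x y ↔ f.value s = f.value x + f.value y := by
  rw [f.map_padd]
  constructor
  · rintro ⟨_, h⟩
    exact (congrArg Gamma.val h).symm
  · intro h
    refine ⟨?_, Gamma.ext h.symm⟩
    exact le_sub_iff_add_le.2 (h ▸ f.value_le s)

theorem exists_mem_padd {x y : E} (h : f.value x + f.value y ≤ u) :
    ∃ s ∈ padd x y, f.value s = f.value x + f.value y := by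
  obtain ⟨s, hs⟩ := f.exists_value (add_nonneg (f.value_nonneg x) (f.value_nonneg y)) h
  exact ⟨s, f.mem_padd_iff.2 hs, hs⟩

theorem value_zero : f.value 0 = 0 := by
  rw [value, f.map_zero]; rfl

theorem value_one : f.value 1 = u := by
  rw [value, f.map_one]; rfl

theorem le_iff {x y : E} : Le x y ↔ f.value x ≤ f.value y := by
  constructor
  · rintro ⟨z, hz⟩
    rw [f.mem_padd_iff.1 hz]
    exact le_add_of_nonneg_right (f.value_nonneg z)
  · intro h
    have h0 : 0 ≤ -f.value x + f.value y := by
      rw [← neg_add_cancel (f.value x)]; exact add_le_add_right h _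
    have h1 : -f.value x + f.value y ≤ u :=
      (add_le_of_nonpos_left (neg_nonpos.2 (f.value_nonneg x))).trans (f.value_le y)
    obtain ⟨z, hz⟩ := f.exists_value h0 h1
    exact ⟨z, f.mem_padd_iff.2 (by rw [hz, add_neg_cancel_left])⟩

theorem value_of_mem_pmul {m : ℕ} {x s : E} (h : s ∈ pmul m x) : f.value s = m • f.value x := by
  induction m generalizing s with
  | zero =>
    obtain rfl := Part.mem_some_iff.1 h
    rw [f.value_zero, zero_nsmul]
  | succ m ih =>
    obtain ⟨t, ht, hs⟩ := Part.mem_bind_iff.1 h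
    rw [f.mem_padd_iff.1 hs, ih ht, succ_nsmul]

theorem mem_pmul {m : ℕ} {x s : E} (h : f.value s = m • f.value x) : s ∈ pmul m x := by
  induction m generalizing s with
  | zero =>
    rw [zero_nsmul, ← f.value_zero] at h
    exact Part.mem_some_iff.2 (f.value_injective h)
  | succ m ih =>
    rw [succ_nsmul] at h
    have h1 : m • f.value x ≤ u :=
      (le_add_of_nonneg_right (f.value_nonneg x)).trans (h ▸ f.value_le s)
    obtain ⟨t, ht⟩ := f.exists_value (nsmul_nonneg (f.value_nonneg x) m) h1
    exact Part.mem_bind_iff.2 ⟨t, ih ht, f.mem_padd_iff.2 (by rw [h, ht])⟩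

include f in
/-- (RDP)₁ passes from a po-group to its intervals. -/
theorem rdp1 (hH : PoGroup.RDP1 H) : RDP1 E := by
  intro a₁ a₂ b₁ b₂ s ha hb
  rw [f.mem_padd_iff] at ha hb
  obtain ⟨c₁₁, c₁₂, c₂₁, c₂₂, n₁₁, n₁₂, n₂₁, n₂₂, e1, e2, e3, e4, hc⟩ :=
    hH _ _ _ _ (f.value_nonneg a₁) (f.value_nonneg a₂) (f.value_nonneg b₁) (f.value_nonneg b₂)
      (ha.symm.trans hb)
  obtain ⟨d₁₁, rfl⟩ := f.exists_value n₁₁ ((le_add_of_nonneg_right n₁₂).trans (e1 ▸ f.value_le a₁))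
  obtain ⟨d₁₂, rfl⟩ := f.exists_value n₁₂ ((le_add_of_nonneg_left n₁₁).trans (e1 ▸ f.value_le a₁))
  obtain ⟨d₂₁, rfl⟩ := f.exists_value n₂₁ ((le_add_of_nonneg_right n₂₂).trans (e2 ▸ f.value_le a₂))
  obtain ⟨d₂₂, rfl⟩ := f.exists_value n₂₂ ((le_add_of_nonneg_left n₂₁).trans (e2 ▸ f.value_le a₂))
  refine ⟨d₁₁, d₁₂, d₂₁, d₂₂, f.mem_padd_iff.2 e1, f.mem_padd_iff.2 e2, f.mem_padd_iff.2 e3,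
    f.mem_padd_iff.2 e4, fun x y hx hy => ?_⟩
  rw [f.le_iff] at hx hy
  -- The sum exists in `E` because `x ≤ c₁₂ ≤ a₁` and `y ≤ c₂₁ ≤ a₂`, whence `x + y ≤ a₁ + a₂ = s`.
  have hle : f.value x + f.value y ≤ u := by
    refine le_trans ?_ (f.value_le s)
    rw [ha, e1, e2]
    exact add_le_add (hx.trans (le_add_of_nonneg_left n₁₁))
      (hy.trans (le_add_of_nonneg_right n₂₂))
  obtain ⟨t, ht, ht'⟩ := f.exists_mem_padd hle
  exact ⟨t, ht, f.mem_padd_iff.2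
    (ht'.trans (hc _ _ (f.value_nonneg x) hx (f.value_nonneg y) hy))⟩

/-- An isomorphism onto `Γ(H, u)` restricts along an injective group homomorphism `K → H` that
identifies the interval `[0, w]` of `K` with `[0, u]`. -/
theorem nonempty_of_addMonoidHom {K : Type*} [AddGroup K] [PartialOrder K] [AddLeftMono K]
    [AddRightMono K] {w : K} (hw : 0 ≤ w) (φ : K →+ H) (hφ : Function.Injective φ) (hφw : φ w = u)
    (hint : ∀ k, (0 ≤ φ k ∧ φ k ≤ u) ↔ (0 ≤ k ∧ k ≤ w))
    (hsurj : ∀ x : E, ∃ k, φ k = f.value x) : Nonempty (Iso E (Gamma w hw)) := by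
  choose r hr using hsurj
  have hmem : ∀ x, 0 ≤ r x ∧ r x ≤ w := fun x =>
    (hint _).1 (by rw [hr]; exact ⟨f.value_nonneg x, f.value_le x⟩)
  let g : E → Gamma w hw := fun x => ⟨r x, (hmem x).1, (hmem x).2⟩
  have hg : Function.Bijective g := by
    constructor
    · intro x y h
      have h' : r x = r y := congrArg Gamma.val h
      exact f.value_injective (by rw [← hr, ← hr, h'])
    · rintro ⟨k, h0, h1⟩
      obtain ⟨h2, h3⟩ := (hint k).2 ⟨h0, h1⟩
      obtain ⟨x, hx⟩ := f.exists_value h2 h3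
      exact ⟨x, Gamma.ext (hφ ((hr x).trans hx))⟩
  refine ⟨⟨Equiv.ofBijective g hg, Gamma.ext (hφ ?_), Gamma.ext (hφ ?_), fun a b s => ?_⟩⟩
  · exact (hr 0).trans (f.value_zero.trans φ.map_zero.symm)
  · exact (hr 1).trans (f.value_one.trans hφw.symm)
  · rw [f.mem_padd_iff, ← hr, ← hr, ← hr, ← φ.map_add, hφ.eq_iff]
    constructor
    · intro h
      exact ⟨le_sub_iff_add_le.2 (h ▸ (hmem s).2), Gamma.ext h.symm⟩
    · rintro ⟨_, h⟩
      exact (congrArg Gamma.val h).symm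

end Value

end Iso

/-! ### Levels and ideals in a lexicographic interval. -/

section LexInterval

variable {E : Type*} [PseudoEffectAlgebra E] {G : Type*} [AddGroup G] [PartialOrder G]
  [AddLeftMono G] [AddRightMono G] {n : ℕ} (f : Iso E (Gamma (lexUnit G n) (lexUnit_nonneg n)))

/-- The first component of the element of `ℤ ×ₗ G` represented by `x`. -/
noncomputable def lexLevel (x : E) : ℤ := (ofLex (f.value x)).1

/-- The decomposition of `Γ(ℤ ×ₗ G, (n, 0))` by the first component. -/
def lexDecomposition (i : Fin (n + 1)) : Set E := {x | lexLevel f x = i}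

theorem lexLevel_nonneg (x : E) : 0 ≤ lexLevel f x := by
  rcases Prod.Lex.le_iff.1 (f.value_nonneg x) with h | h
  · exact h.le
  · exact h.1.le

theorem lexLevel_le (x : E) : lexLevel f x ≤ n := by
  rcases Prod.Lex.le_iff.1 (f.value_le x) with h | h
  · exact h.le
  · exact h.1.le

theorem lexLevel_add {x y s : E} (h : s ∈ padd x y) :
    lexLevel f s = lexLevel f x + lexLevel f y :=
  congrArg (fun z => (ofLex z).1) (f.mem_padd_iff.1 h)

theorem lexLevel_one : lexLevel f 1 = n := by
  rw [lexLevel, f.value_one]; rfl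

theorem lexLevel_mono {x y : E} (h : Le x y) : lexLevel f x ≤ lexLevel f y := by
  obtain ⟨z, hz⟩ := h
  rw [lexLevel_add f hz]
  exact le_add_of_nonneg_right (lexLevel_nonneg f z)

theorem le_of_lexLevel_lt {x y : E} (h : lexLevel f x < lexLevel f y) : Le x y :=
  f.le_iff.2 (Prod.Lex.le_iff.2 (Or.inl h))

theorem isDecomposition_lexDecomposition :
    IsDecomposition n (lexDecomposition f) where
  nonempty i := by
    rcases Nat.lt_or_ge i n with hi | hi
    · have h0 : (0 : ℤ ×ₗ G) ≤ toLex ((i : ℤ), 0) := by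
        rw [toLex_nonneg_iff]
        rcases Nat.eq_zero_or_pos i with h | h
        · exact Or.inr ⟨by exact_mod_cast h, le_rfl⟩
        · exact Or.inl (by exact_mod_cast h)
      obtain ⟨x, hx⟩ := f.exists_value h0 (toLex_le_lexUnit_iff.2 (Or.inl (by exact_mod_cast hi)))
      exact ⟨x, congrArg (fun z : ℤ ×ₗ G => (ofLex z).1) hx⟩
    · refine ⟨1, ?_⟩
      have : (i : ℕ) = n := by omega
      change lexLevel f 1 = _
      rw [lexLevel_one, this]
  disjoint i j hij := by
    ext x
    simp only [lexDecomposition, Set.mem_inter_iff, Set.mem_ofPred_eq, Set.mem_empty_iff_false,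
      iff_false]
    omega
  cover := by
    ext x
    simp only [Set.mem_iUnion, Set.mem_univ, iff_true]
    have h0 := lexLevel_nonneg f x
    have h1 := lexLevel_le f x
    refine ⟨⟨(lexLevel f x).toNat, by omega⟩, ?_⟩
    change lexLevel f x = ((lexLevel f x).toNat : ℤ)
    omega
  leftCompl_eq i := by
    ext y
    constructor
    · rintro ⟨x, hx, h⟩
      have := lexLevel_add f h
      rw [lexLevel_one] at this
      change lexLevel f x = _ at hx
      change lexLevel f y = _
      rw [Fin.val_rev]
      omega
    · intro hy
      obtain ⟨x, hx, -⟩ := existsUnique_right y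
      refine ⟨x, ?_, hx⟩
      have := lexLevel_add f hx
      rw [lexLevel_one] at this
      change lexLevel f y = _ at hy
      change lexLevel f x = _
      rw [Fin.val_rev] at hy
      omega
  rightCompl_eq i := by
    ext y
    constructor
    · rintro ⟨x, hx, h⟩
      have := lexLevel_add f h
      rw [lexLevel_one] at this
      change lexLevel f x = _ at hx
      change lexLevel f y = _
      rw [Fin.val_rev]
      omega
    · intro hy
      obtain ⟨x, hx, -⟩ := existsUnique_left y
      refine ⟨x, ?_, hx⟩
      have := lexLevel_add f hx
      rw [lexLevel_one] at this
      change lexLevel f y = _ at hy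
      change lexLevel f x = _
      rw [Fin.val_rev] at hy
      omega
  add_mem i j x y s hx hy hs := by
    have h := lexLevel_add f hs
    have h1 := lexLevel_le f s
    change lexLevel f x = _ at hx
    change lexLevel f y = _ at hy
    refine ⟨⟨i + j, by omega⟩, rfl, ?_⟩
    change lexLevel f s = ((i + j : ℕ) : ℤ)
    push_cast
    omega

theorem isIdeal_lexDecomposition_zero : IsIdeal (lexDecomposition f 0) where
  nonempty := ⟨0, by
    change (ofLex (f.value 0)).1 = 0
    rw [f.value_zero]; rfl⟩
  down a i hi h := by
    have h1 := lexLevel_mono f h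
    have h2 := lexLevel_nonneg f a
    change lexLevel f i = 0 at hi
    change lexLevel f a = 0
    omega
  add i j s hi hj hs := by
    have h := lexLevel_add f hs
    change lexLevel f i = 0 at hi
    change lexLevel f j = 0 at hj
    change lexLevel f s = 0
    omega

/-- An ideal of `Γ(ℤ ×ₗ G, (n, 0))` with an element of positive level is improper. -/
theorem one_mem_of_lexLevel_pos (hn : 1 ≤ n) (hG : Directed G) {I : Set E} (hI : IsIdeal I)
    {x : E} (hx : x ∈ I) (hpos : 0 < lexLevel f x) : (1 : E) ∈ I := by
  have zero_mem : ∀ y, lexLevel f y = 0 → y ∈ I := fun y hy =>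
    hI.down _ _ hx (le_of_lexLevel_lt f (by omega))
  -- Since `I` contains all of level `0`, the second coordinate of a member can be raised without
  -- leaving `I`. Raising that of `x` yields `(n, 0)` if `x` has level `n`, and otherwise an element
  -- above `(1, 0)`, whose `n`-fold sum is `1`.
  have step : ∀ y ∈ I, ∀ g : G, 0 ≤ g → f.value y + toLex (0, g) ≤ lexUnit G n →
      ∃ z ∈ I, f.value z = f.value y + toLex (0, g) := by
    intro y hy g hg hle
    have hg0 : 0 ≤ (toLex (0, g) : ℤ ×ₗ G) := toLex_nonneg_iff.2 (Or.inr ⟨rfl, hg⟩)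
    have hg1 : (toLex (0, g) : ℤ ×ₗ G) ≤ lexUnit G n :=
      toLex_le_lexUnit_iff.2 (Or.inl (by omega))
    obtain ⟨d, hd⟩ := f.exists_value hg0 hg1
    rw [← hd] at hle
    obtain ⟨s, hs, hs'⟩ := f.exists_mem_padd hle
    refine ⟨s, hI.add _ _ _ hy (zero_mem d ?_) hs, by rw [hs', hd]⟩
    rw [lexLevel, hd]; rfl
  obtain ⟨⟨k, g⟩, hk⟩ := toLex.surjective (f.value x)
  have hxk : lexLevel f x = k := by rw [lexLevel, ← hk]; rfl
  have hkn := lexLevel_le f x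
  by_cases htop : k = n
  · have hg : g ≤ 0 := by
      have := f.value_le x
      rw [← hk, toLex_le_lexUnit_iff] at this
      exact (this.resolve_left (by omega)).2
    have hsum : f.value x + toLex (0, -g) = lexUnit G n := by
      rw [← hk, toLex_add_toLex, add_zero, add_neg_cancel, htop]; rfl
    obtain ⟨z, hz, hz'⟩ := step x hx (-g) (neg_nonneg.2 hg) hsum.le
    rwa [← f.value_injective (hz'.trans (hsum.trans f.value_one.symm))]
  · obtain ⟨c, hc⟩ := f.exists_value (h := toLex (1, 0))
      (toLex_nonneg_iff.2 (Or.inl one_pos))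
      (toLex_le_lexUnit_iff.2 (Or.inl (by omega)))
    have hcI : c ∈ I := by
      obtain ⟨m, hm1, hm2⟩ := hG (-g) 0
      have hz1 : f.value x + toLex (0, m) ≤ lexUnit G n := by
        rw [← hk, toLex_add_toLex]
        exact toLex_le_lexUnit_iff.2 (Or.inl (by omega))
      obtain ⟨z, hz, hz'⟩ := step x hx m hm2 hz1
      refine hI.down _ _ hz (f.le_iff.2 ?_)
      rw [hc, hz', ← hk, toLex_add_toLex, Prod.Lex.toLex_le_toLex]
      rcases (show 1 < k ∨ 1 = k by omega) with h | h
      · exact Or.inl (by simpa using h)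
      · refine Or.inr ⟨by simpa using h, ?_⟩
        rw [← add_neg_cancel g]
        exact add_le_add_right hm1 _
    have mult : ∀ m : ℕ, m ≤ n → ∃ z ∈ I, f.value z = toLex ((m : ℤ), 0) := by
      intro m
      induction m with
      | zero =>
        intro _
        refine ⟨0, zero_mem 0 ?_, f.value_zero⟩
        rw [lexLevel, f.value_zero]; rfl
      | succ m ih =>
        intro hm
        obtain ⟨z, hz, hz'⟩ := ih (by omega)
        have e : f.value z + f.value c = toLex (((m + 1 : ℕ) : ℤ), 0) := by
          rw [hz', hc, toLex_add_toLex, add_zero]; rfl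
        have hle : f.value z + f.value c ≤ lexUnit G n := by
          rw [e, toLex_le_lexUnit_iff]
          rcases hm.lt_or_eq with h | h
          · exact Or.inl (by exact_mod_cast h)
          · exact Or.inr ⟨by exact_mod_cast h, le_rfl⟩
        obtain ⟨s, hs, hs'⟩ := f.exists_mem_padd hle
        exact ⟨s, hI.add _ _ _ hz hcI hs, hs'.trans e⟩
    obtain ⟨z, hz, hz'⟩ := mult n le_rfl
    rwa [← f.value_injective (hz'.trans f.value_one.symm)]

/-- Every proper ideal lies in level `0`, which is itself a proper ideal; hence it is the only
maximal one. -/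
theorem isPerfectDecomposition_lexDecomposition (hn : 1 ≤ n) (hG : Directed G) :
    IsPerfectDecomposition n (lexDecomposition f) := by
  have sub : ∀ J : Set E, IsIdeal J → (1 : E) ∉ J → J ⊆ lexDecomposition f 0 := by
    intro J hJ h1 x hx
    by_contra hne
    change ¬ lexLevel f x = 0 at hne
    have := lexLevel_nonneg f x
    exact h1 (one_mem_of_lexLevel_pos f hn hG hJ hx (by omega))
  have proper : (1 : E) ∉ lexDecomposition f 0 := by
    intro h
    change lexLevel f 1 = 0 at h
    rw [lexLevel_one] at h
    omega
  refine ⟨isDecomposition_lexDecomposition f, ?_,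
    ⟨isIdeal_lexDecomposition_zero f, proper, fun J hJ h1 h => (sub J hJ h1).antisymm h⟩,
    fun I hI => (hI.maximal _ (isIdeal_lexDecomposition_zero f) proper
      (sub I hI.isIdeal hI.proper)).symm⟩
  intro i j hij x hx y hy
  change lexLevel f x = _ at hx
  change lexLevel f y = _ at hy
  have : f.value x + f.value y ≤ lexUnit G n := by
    refine Prod.Lex.le_iff.2 (Or.inl ?_)
    change lexLevel f x + lexLevel f y < n
    omega
  obtain ⟨s, hs, -⟩ := f.exists_mem_padd this
  exact Part.dom_iff_mem.2 ⟨s, hs⟩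

end LexInterval

theorem IsRepresentedBy.isStrongPerfect {n : ℕ} (hn : 1 ≤ n) {E : Type u} [PseudoEffectAlgebra E]
    {G : Type u} [AddGroup G] [PartialOrder G] [AddLeftMono G] [AddRightMono G]
    (h : IsRepresentedBy n E G) : IsStrongPerfect n E := by
  obtain ⟨htf, hd, hr, ⟨f⟩⟩ := h
  obtain ⟨c, hc⟩ := f.exists_value (h := toLex (1, 0)) (toLex_nonneg_iff.2 (Or.inl one_pos)) (by
    rw [toLex_le_lexUnit_iff]
    rcases hn.lt_or_eq with h | h
    · exact Or.inl (by exact_mod_cast h)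
    · exact Or.inr ⟨by exact_mod_cast h, le_rfl⟩)
  refine ⟨f.rdp1 hr, lexDecomposition f, isPerfectDecomposition_lexDecomposition f hn hd,
    ℤ ×ₗ G, inferInstance, inferInstance, inferInstance, inferInstance, lexUnit G n,
    isStrongUnit_lexUnit hn, f, htf.lex, ⟨1, by omega⟩, c, rfl, ?_, ?_, ?_⟩
  · change lexLevel f c = 1
    rw [lexLevel, hc]; rfl
  · refine f.mem_pmul ?_
    rw [f.value_one, hc, nsmul_toLex, nsmul_zero, nsmul_one]; rfl
  · intro x
    obtain ⟨⟨k, g⟩, rfl⟩ := toLex.surjective x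
    change _ + f.value c = f.value c + _
    rw [hc, toLex_add_toLex, toLex_add_toLex, add_comm, add_zero, zero_add]

/-! ### Uniqueness of the representing group. -/

section Uniqueness

variable {E : Type*} [PseudoEffectAlgebra E] {n : ℕ}
  {G G' : Type*} [AddGroup G] [PartialOrder G] [AddLeftMono G] [AddRightMono G]
  [AddGroup G'] [PartialOrder G'] [AddLeftMono G'] [AddRightMono G']

/-- The element of level `0` represented by an element of the positive cone. -/
theorem exists_value_eq_toLex_zero (hn : 1 ≤ n)
    (f : Iso E (Gamma (lexUnit G n) (lexUnit_nonneg n))) {g : G} (hg : 0 ≤ g) :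
    ∃ x, f.value x = toLex (0, g) :=
  f.exists_value (toLex_nonneg_iff.2 (Or.inr ⟨rfl, hg⟩))
    (toLex_le_lexUnit_iff.2 (Or.inl (by omega)))

/-- Level `0` is the unique maximal ideal in either representation, so both single out the same
elements of `E`; these are identified with the cone of `G` and with that of `G'`. -/
theorem exists_coneMap (hn : 1 ≤ n) (hG : Directed G) (hG' : Directed G')
    (f : Iso E (Gamma (lexUnit G n) (lexUnit_nonneg n)))
    (f' : Iso E (Gamma (lexUnit G' n) (lexUnit_nonneg n))) :
    ∃ φ : G → G', ∀ g, 0 ≤ g →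
      0 ≤ φ g ∧ ∀ x, f.value x = toLex (0, g) → f'.value x = toLex (0, φ g) := by
  have hD : lexDecomposition f 0 = lexDecomposition f' 0 :=
    (isPerfectDecomposition_lexDecomposition f' hn hG').unique _
      (isPerfectDecomposition_lexDecomposition f hn hG).isMaximal
  have ex : ∀ g : G, ∃ g' : G', 0 ≤ g → 0 ≤ g' ∧
      ∀ x, f.value x = toLex (0, g) → f'.value x = toLex (0, g') := by
    intro g
    by_cases hg : 0 ≤ g
    · obtain ⟨x, hx⟩ := exists_value_eq_toLex_zero hn f hg
      obtain ⟨⟨k, g'⟩, hk⟩ := toLex.surjective (f'.value x)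
      have hx0 : x ∈ lexDecomposition f' 0 := by
        rw [← hD]
        change lexLevel f x = 0
        rw [lexLevel, hx]; rfl
      change lexLevel f' x = 0 at hx0
      obtain rfl : k = 0 := by rw [lexLevel, ← hk] at hx0; exact hx0
      refine ⟨g', fun _ => ⟨?_, fun y hy => ?_⟩⟩
      · have := f'.value_nonneg x
        rw [← hk, toLex_nonneg_iff] at this
        simpa using this
      · rw [f.value_injective (hy.trans hx.symm), hk]
    -- Default value off the positive cone, where nothing is claimed.
    · exact ⟨0, fun h => absurd h hg⟩
  choose φ hφ using ex
  exact ⟨φ, hφ⟩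

theorem nonempty_orderAddMonoidIso_of_lex (hn : 1 ≤ n) (hG : Directed G) (hG' : Directed G')
    (f : Iso E (Gamma (lexUnit G n) (lexUnit_nonneg n)))
    (f' : Iso E (Gamma (lexUnit G' n) (lexUnit_nonneg n))) : Nonempty (G ≃+o G') := by
  obtain ⟨φ, hφ⟩ := exists_coneMap hn hG hG' f f'
  obtain ⟨ψ, hψ⟩ := exists_coneMap hn hG' hG f' f
  refine hG.nonempty_orderAddMonoidIso hG' φ ψ ?_ ?_ (fun a ha => (hφ a ha).1)
    (fun a ha => (hψ a ha).1) ?_ ?_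
  · intro a b ha hb
    obtain ⟨x, hx⟩ := exists_value_eq_toLex_zero hn f ha
    obtain ⟨y, hy⟩ := exists_value_eq_toLex_zero hn f hb
    obtain ⟨z, hz⟩ := exists_value_eq_toLex_zero hn f (add_nonneg ha hb)
    have h := f.mem_padd_iff.2 (show f.value z = f.value x + f.value y by rw [hx, hy, hz]; rfl)
    rw [f'.mem_padd_iff, (hφ _ ha).2 x hx, (hφ _ hb).2 y hy, (hφ _ (add_nonneg ha hb)).2 z hz,
      toLex_add_toLex] at h
    exact congrArg (fun w => (ofLex w).2) h
  · intro a b ha hb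
    obtain ⟨x, hx⟩ := exists_value_eq_toLex_zero hn f' ha
    obtain ⟨y, hy⟩ := exists_value_eq_toLex_zero hn f' hb
    obtain ⟨z, hz⟩ := exists_value_eq_toLex_zero hn f' (add_nonneg ha hb)
    have h := f'.mem_padd_iff.2 (show f'.value z = f'.value x + f'.value y by rw [hx, hy, hz]; rfl)
    rw [f.mem_padd_iff, (hψ _ ha).2 x hx, (hψ _ hb).2 y hy, (hψ _ (add_nonneg ha hb)).2 z hz,
      toLex_add_toLex] at h
    exact congrArg (fun w => (ofLex w).2) h
  · intro a ha
    obtain ⟨x, hx⟩ := exists_value_eq_toLex_zero hn f ha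
    have h := (hψ _ (hφ a ha).1).2 x ((hφ a ha).2 x hx)
    exact congrArg (fun w => (ofLex w).2) (h.symm.trans hx)
  · intro a ha
    obtain ⟨x, hx⟩ := exists_value_eq_toLex_zero hn f' ha
    have h := (hφ _ (hψ a ha).1).2 x ((hψ a ha).2 x hx)
    exact congrArg (fun w => (ofLex w).2) (h.symm.trans hx)

end Uniqueness

end PseudoEffectAlgebra

/-! ### From a decomposition to a level function. -/

namespace PseudoEffectAlgebra

open PoGroup

/-- The function `lev` assigns to the elements of an `n`-perfect pseudo-effect algebra the index of
the part of the `n`-decomposition that they lie in. -/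
structure IsLevel {E : Type*} [PseudoEffectAlgebra E] (n : ℕ) (lev : E → ℕ) : Prop where
  add : ∀ {x y s : E}, s ∈ padd x y → lev s = lev x + lev y
  one : lev 1 = n
  exists_add : ∀ {x y : E}, lev x + lev y < n → ∃ s, s ∈ padd x y
  isMaximal : IsMaximalIdeal {x : E | lev x = 0}

theorem IsPerfectDecomposition.exists_isLevel {E : Type*} [PseudoEffectAlgebra E] {n : ℕ}
    {D : Fin (n + 1) → Set E} (hD : IsPerfectDecomposition n D)
    (h0 : (0 : E) ∈ padd 0 0) (h01 : (1 : E) ∈ padd 1 0) :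
    ∃ lev : E → ℕ, IsLevel n lev ∧ ∀ (x : E) (i : Fin (n + 1)), x ∈ D i ↔ lev x = i := by
  have ex : ∀ x : E, ∃ i, x ∈ D i := fun x =>
    Set.mem_iUnion.1 (hD.isDecomposition.cover ▸ Set.mem_univ x)
  choose lev hlev using ex
  have huniq : ∀ {x i}, x ∈ D i → lev x = i := by
    intro x i hx
    by_contra hne
    have := hD.isDecomposition.disjoint _ _ hne
    exact (Set.mem_empty_iff_false x).1 (this ▸ ⟨hlev x, hx⟩)
  have hadd : ∀ {x y s : E}, s ∈ padd x y → (lev s : ℕ) = lev x + lev y := by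
    intro x y s hs
    obtain ⟨k, hk, hsk⟩ := hD.isDecomposition.add_mem _ _ _ _ _ (hlev x) (hlev y) hs
    rw [huniq hsk, hk]
  have hiff : ∀ (x : E) (i : Fin (n + 1)), x ∈ D i ↔ (lev x : ℕ) = i := fun x i =>
    ⟨fun h => congrArg _ (huniq h), fun h => Fin.ext h ▸ hlev x⟩
  have hD0 : {x : E | (lev x : ℕ) = 0} = D 0 := by
    ext x
    exact (hiff x 0).symm
  refine ⟨fun x => lev x, ⟨hadd, ?_, ?_, ?_⟩, hiff⟩
  · have hz : (lev 0 : ℕ) = 0 := by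
      have := hadd h0
      omega
    -- The level of `1` is `n` because `1 = 0⁻` and the complements of `D 0` make up `D n`.
    have h1 : (1 : E) ∈ leftCompl (D 0) := ⟨0, (hiff 0 0).2 hz, h01⟩
    rw [hD.isDecomposition.leftCompl_eq, hiff, Fin.val_rev] at h1
    simpa using h1
  · intro x y h
    exact Part.dom_iff_mem.1 (hD.exists_add _ _ h x (hlev x) y (hlev y))
  · exact hD0 ▸ hD.isMaximal

/-- `IdealSpan x` consists of the finite sums of elements below `x`; under (RDP)₁ this is the ideal
generated by `x`. -/
inductive IdealSpan {E : Type*} [PseudoEffectAlgebra E] (x : E) : E → Prop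
  | zero : IdealSpan x 0
  | add {y w s : E} : Le y x → IdealSpan x w → s ∈ padd y w → IdealSpan x s

/-! ### Principal ideals under (RDP)₁. -/

section Span

variable {E : Type*} [PseudoEffectAlgebra E] {H : Type*} [AddGroup H] [PartialOrder H]
  [AddLeftMono H] [AddRightMono H] {u : H} {hu : 0 ≤ u} (f : Iso E (Gamma u hu))

include f

theorem IdealSpan.of_le {x y : E} (h : Le y x) : IdealSpan x y :=
  .add h .zero (f.mem_padd_iff.2 (by rw [f.value_zero, add_zero]))

theorem IdealSpan.mem_of_le (hE : RDP1 E) {x w y : E} (hw : IdealSpan x w) (hy : Le y w) :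
    IdealSpan x y := by
  induction hw generalizing y with
  | zero =>
    have : y = 0 := f.value_injective (le_antisymm (f.le_iff.1 hy)
      (by rw [f.value_zero]; exact f.value_nonneg y))
    rw [this]
    exact .zero
  | add h1 _ hs ih =>
    obtain ⟨d, hd⟩ := hy
    -- Refinement splits the smaller element into `c₁₁`, below the first summand, and `c₁₂`, below
    -- the rest, where induction applies.
    obtain ⟨c₁₁, c₁₂, c₂₁, c₂₂, e1, e2, e3, e4, -⟩ := hE _ _ _ _ _ hd hs
    refine .add ?_ (ih ⟨c₂₂, e4⟩) e1
    exact f.le_iff.2 ((f.le_iff.1 ⟨c₂₁, e3⟩).trans (f.le_iff.1 h1))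

theorem IdealSpan.isIdeal (hE : RDP1 E) (x : E) : IsIdeal {y | IdealSpan x y} where
  nonempty := ⟨0, .zero⟩
  down _ _ hi ha := IdealSpan.mem_of_le f hE hi ha
  add i j s hi hj hs := by
    induction hi generalizing s with
    | zero =>
      rw [f.mem_padd_iff, f.value_zero, zero_add] at hs
      rw [f.value_injective hs]
      exact hj
    | @add y w t h1 _ ht ih =>
      obtain ⟨r, hr, hr'⟩ := (assoc y w j s).1 ⟨t, ht, hs⟩
      exact .add h1 (ih r hr) hr'

end Span

/-! ### The subgroup of infinitesimals. -/

namespace IsLevel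

variable {E : Type*} [PseudoEffectAlgebra E] {H : Type*} [AddGroup H] [PartialOrder H]
  [AddLeftMono H] [AddRightMono H] {u : H} {hu : 0 ≤ u} (f : Iso E (Gamma u hu))
  {n : ℕ} {lev : E → ℕ} (hl : IsLevel n lev)

include hl

theorem exists_add_one (y : E) : ∃ z, 1 ∈ padd y z ∧ lev y + lev z = n := by
  obtain ⟨z, hz, -⟩ := existsUnique_right y
  exact ⟨z, hz, by rw [← hl.add hz, hl.one]⟩

theorem le_n (y : E) : lev y ≤ n := by
  obtain ⟨z, -, hz⟩ := hl.exists_add_one y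
  omega

theorem mono {x y : E} (h : Le x y) : lev x ≤ lev y := by
  obtain ⟨z, hz⟩ := h
  rw [hl.add hz]
  exact Nat.le_add_right _ _

include f in
theorem zero : lev 0 = 0 := by
  have := hl.add (f.mem_padd_iff.2 (show f.value 0 = f.value 0 + f.value 0 by simp [f.value_zero]))
  omega

/-- Elements of smaller level are smaller. -/
theorem value_le_of_lt {x y : E} (h : lev x < lev y) : f.value x ≤ f.value y := by
  obtain ⟨z, hz, hyz⟩ := hl.exists_add_one y
  obtain ⟨s, hs⟩ := hl.exists_add (x := x) (y := z) (by omega)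
  have h1 := f.mem_padd_iff.1 hs
  have h2 := f.mem_padd_iff.1 hz
  rw [f.value_one] at h2
  have h3 := (f.value_le s).trans_eq h2
  rw [h1] at h3
  exact (add_le_add_iff_right _).1 h3

theorem exists_infinitesimal_add (hn : 1 ≤ n) {a b : E} (ha : lev a = 0) (hb : lev b = 0) :
    ∃ s, lev s = 0 ∧ f.value s = f.value a + f.value b ∧ s ∈ padd a b := by
  obtain ⟨s, hs⟩ := hl.exists_add (x := a) (y := b) (by omega)
  exact ⟨s, by rw [hl.add hs, ha, hb], f.mem_padd_iff.1 hs, hs⟩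

/-- The subgroup of `H` generated by the elements of level `0`. -/
def infinitesimals (hn : 1 ≤ n) : AddSubgroup H where
  carrier := {h | ∃ a b, lev a = 0 ∧ lev b = 0 ∧ h + f.value b = f.value a}
  zero_mem' := ⟨0, 0, hl.zero f, hl.zero f, zero_add _⟩
  neg_mem' := by
    rintro h ⟨a, b, ha, hb, e⟩
    exact ⟨b, a, hb, ha, by rw [← e, neg_add_cancel_left]⟩
  add_mem' := by
    rintro h h' ⟨a, b, ha, hb, e⟩ ⟨a', b', ha', hb', e'⟩
    obtain ⟨s, hs, hsv, hsm⟩ := hl.exists_infinitesimal_add f hn hb ha'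
    -- By (PE3) `b + a' = a' + y`, so `(a - b) + (a' - b') = (a + a') - (b' + y)`; additivity of
    -- levels puts `y` at level `0`.
    obtain ⟨_, y, _, hy⟩ := exists_conj _ _ _ hsm
    have hy0 : lev y = 0 := by
      have := hl.add hy
      omega
    obtain ⟨p, hp, hpv, -⟩ := hl.exists_infinitesimal_add f hn ha ha'
    obtain ⟨q, hq, hqv, -⟩ := hl.exists_infinitesimal_add f hn hb' hy0
    refine ⟨p, q, hp, hq, ?_⟩
    rw [f.mem_padd_iff, hsv] at hy
    calc h + h' + f.value q = h + (h' + f.value b' + f.value y) := by rw [hqv]; simp only [add_assoc]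
      _ = h + f.value b + f.value a' := by rw [e', ← hy, add_assoc]
      _ = f.value p := by rw [e, hpv]

theorem value_mem_infinitesimals (hn : 1 ≤ n) {a : E} (ha : lev a = 0) :
    f.value a ∈ hl.infinitesimals f hn :=
  ⟨a, 0, ha, hl.zero f, by rw [f.value_zero, add_zero]⟩

theorem exists_value_of_mem_infinitesimals (hn : 1 ≤ n) {h : H}
    (hh : h ∈ hl.infinitesimals f hn) (h0 : 0 ≤ h) : ∃ a, lev a = 0 ∧ f.value a = h := by
  obtain ⟨a, b, ha, hb, e⟩ := hh
  have hle : h ≤ f.value a := by rw [← e]; exact le_add_of_nonneg_right (f.value_nonneg b)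
  obtain ⟨x, rfl⟩ := f.exists_value h0 (hle.trans (f.value_le a))
  refine ⟨x, ?_, rfl⟩
  have := hl.mono (f.le_iff.2 hle)
  omega

theorem exists_le_value (hn : 1 ≤ n) {h : H} (hh : h ∈ hl.infinitesimals f hn) :
    ∃ a, lev a = 0 ∧ h ≤ f.value a := by
  obtain ⟨a, b, ha, hb, e⟩ := hh
  exact ⟨a, ha, by rw [← e]; exact le_add_of_nonneg_right (f.value_nonneg b)⟩

/-- Sums in the ideal generated by `x` of level `1` involve at most one term of level `1`. -/
theorem exists_of_idealSpan (hn : 1 ≤ n) {x w : E} (hw : IdealSpan x w) (h1 : lev w = 1) :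
    ∃ y, Le y x ∧ lev y = 1 ∧ ∃ g₁ ∈ hl.infinitesimals f hn, ∃ g₂ ∈ hl.infinitesimals f hn,
      f.value w = g₁ + f.value y + g₂ := by
  induction hw with
  | zero => rw [hl.zero f] at h1; omega
  | @add y w s hy _ hs ih =>
    have hadd := hl.add hs
    have hv := f.mem_padd_iff.1 hs
    -- A first summand of level `0` is absorbed into `g₁`; one of level `1` leaves a tail of level
    -- `0`, which becomes `g₂`.
    rcases Nat.eq_zero_or_pos (lev y) with h0 | hpos
    · obtain ⟨z, hz, hz1, g₁, hg₁, g₂, hg₂, e⟩ := ih (by omega)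
      exact ⟨z, hz, hz1, f.value y + g₁, add_mem (hl.value_mem_infinitesimals f hn h0) hg₁, g₂, hg₂,
        by rw [hv, e]; simp only [add_assoc]⟩
    · exact ⟨y, hy, by omega, 0, zero_mem _, f.value w,
        hl.value_mem_infinitesimals f hn (by omega), by rw [hv, zero_add]⟩

-- The ideal generated by `x` contains level `0`, whose elements all lie below `x`, and also `x`
-- itself; maximality of level `0` forbids it to be proper.
include f in
theorem idealSpan_one (hE : RDP1 E) {x : E} (hx : lev x = 1) : IdealSpan x 1 := by
  by_contra h
  have hJ := hl.isMaximal.maximal {y | IdealSpan x y} (IdealSpan.isIdeal f hE x) h (by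
    intro y hy
    have hy' : lev y = 0 := hy
    exact IdealSpan.of_le f (f.le_iff.2 (hl.value_le_of_lt f (by omega))))
  have hmem : x ∈ {y | IdealSpan x y} := IdealSpan.of_le f (f.le_iff.2 le_rfl)
  rw [hJ] at hmem
  have : lev x = 0 := hmem
  omega

/-! ### Coordinates with respect to the central element. -/

section Central

variable (hn : 1 ≤ n) (hE : RDP1 E) {c : E} (hc1 : lev c = 1)
  (hcomm : ∀ x : H, AddCommute (f.value c) x)

include hE hc1 hcomm

/-- Every element is, up to infinitesimals, a multiple of the central element of level `1`. -/
theorem exists_value_eq (x : E) :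
    ∃ g ∈ hl.infinitesimals f hn, f.value x = lev x • f.value c + g := by
  induction hk : lev x generalizing x with
  | zero =>
    exact ⟨f.value x, hl.value_mem_infinitesimals f hn hk, by rw [zero_nsmul, zero_add]⟩
  | succ k ih =>
    rcases Nat.eq_zero_or_pos k with rfl | hpos
    · have hspan : IdealSpan x c := IdealSpan.mem_of_le f hE (hl.idealSpan_one f hE hk)
        (f.le_iff.2 (by rw [f.value_one]; exact f.value_le c))
      obtain ⟨y, ⟨z, hz⟩, hy1, g₁, hg₁, g₂, hg₂, e⟩ := hl.exists_of_idealSpan f hn hspan hc1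
      have hz0 : lev z = 0 := by
        have := hl.add hz
        omega
      refine ⟨-g₁ + -g₂ + f.value z, add_mem (add_mem (neg_mem hg₁) (neg_mem hg₂))
        (hl.value_mem_infinitesimals f hn hz0), ?_⟩
      -- From `c = g₁ + y + g₂`, centrality of `c` moves `-g₁` to its right.
      have e' : f.value y = f.value c + (-g₁ + -g₂) := by
        rw [← add_assoc, (hcomm (-g₁)).eq, e]
        simp [add_assoc]
      rw [f.mem_padd_iff.1 hz, e', zero_add, one_nsmul, add_assoc]
    · obtain ⟨z, hz⟩ := f.le_iff.2 (hl.value_le_of_lt f (show lev c < lev x by omega))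
      have hz1 := hl.add hz
      obtain ⟨g, hg, e⟩ := ih z (by omega)
      refine ⟨g, hg, ?_⟩
      rw [f.mem_padd_iff.1 hz, e, succ_nsmul', add_assoc]

omit hE hc1 in
/-- The homomorphism `ℤ ×ₗ G → H`, `(k, g) ↦ k c + g`, for the group `G` of infinitesimals. -/
def lexHom : ℤ ×ₗ hl.infinitesimals f hn →+ H where
  toFun z := (ofLex z).1 • f.value c + (ofLex z).2
  map_zero' := by
    change (0 : ℤ) • f.value c + 0 = 0
    simp
  map_add' z w := by
    change ((ofLex z).1 + (ofLex w).1) • f.value c + (((ofLex z).2 : H) + (ofLex w).2) = _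
    rw [add_zsmul, add_assoc, add_assoc, add_left_cancel_iff, ← add_assoc, ← add_assoc,
      ((hcomm _).zsmul_left (ofLex w).1).eq]

omit hE hc1 in
theorem lexHom_toLex (k : ℤ) (g : hl.infinitesimals f hn) :
    hl.lexHom f hn hcomm (toLex (k, g)) = k • f.value c + g := rfl

-- If `k c + g = 0` with `k > 0`, then `c ≤ k c = -g` lies below an element of level `0`,
-- contradicting that `c` has level `1`.
omit hE in
theorem lexHom_injective : Function.Injective (hl.lexHom f hn hcomm) := by
  have pos : ∀ (k : ℤ) (g : hl.infinitesimals f hn), 0 < k → k • f.value c + (g : H) ≠ 0 := by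
    rintro k g hk h
    obtain ⟨m, rfl⟩ := Int.eq_ofNat_of_zero_le hk.le
    obtain ⟨m, rfl⟩ := Nat.exists_eq_succ_of_ne_zero (show m ≠ 0 by omega)
    obtain ⟨a, ha, hga⟩ := hl.exists_le_value f hn (neg_mem g.2)
    have h1 : f.value c ≤ f.value a := by
      refine le_trans ?_ hga
      rw [← eq_neg_iff_add_eq_zero.2 h, natCast_zsmul, succ_nsmul]
      exact le_add_of_nonneg_left (nsmul_nonneg (f.value_nonneg c) _)
    have := hl.mono (f.le_iff.2 h1)
    omega
  rw [injective_iff_map_eq_zero]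
  intro z hz
  obtain ⟨⟨k, g⟩, rfl⟩ := toLex.surjective z
  rw [lexHom_toLex] at hz
  rcases lt_trichotomy k 0 with hk | rfl | hk
  · refine absurd ?_ (pos (-k) (-g) (by omega))
    rw [AddSubgroup.coe_neg, neg_zsmul, ← neg_add_rev, ← ((hcomm (g : H)).zsmul_left k).eq, hz,
      neg_zero]
  · rw [zero_zsmul, zero_add] at hz
    have : g = 0 := Subtype.ext hz
    rw [this]; rfl
  · exact absurd hz (pos k g hk)

/-- An element of `[0, u]` has coordinates given by its level, and injectivity makes these the only
ones. Conversely, infinitesimals lie below every positive multiple of `c`, so the first coordinate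
decides positivity unless it is `0`. -/
theorem lexHom_mem_interval_iff (hnc : u = n • f.value c) (z : ℤ ×ₗ hl.infinitesimals f hn) :
    (0 ≤ hl.lexHom f hn hcomm z ∧ hl.lexHom f hn hcomm z ≤ u) ↔
      (0 ≤ z ∧ z ≤ lexUnit (hl.infinitesimals f hn) n) := by
  obtain ⟨⟨k, g⟩, rfl⟩ := toLex.surjective z
  have small : ∀ g ∈ hl.infinitesimals f hn, ∀ k : ℤ, 0 < k → g ≤ k • f.value c := by
    intro g hg k hk
    obtain ⟨m, rfl⟩ := Int.eq_ofNat_of_zero_le hk.le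
    obtain ⟨m, rfl⟩ := Nat.exists_eq_succ_of_ne_zero (show m ≠ 0 by omega)
    obtain ⟨a, ha, hga⟩ := hl.exists_le_value f hn hg
    refine (hga.trans (hl.value_le_of_lt f (show lev a < lev c by omega))).trans ?_
    rw [natCast_zsmul, succ_nsmul]
    exact le_add_of_nonneg_left (nsmul_nonneg (f.value_nonneg c) _)
  constructor
  · rintro ⟨h0, h1⟩
    obtain ⟨x, hx⟩ := f.exists_value h0 h1
    obtain ⟨g', hg', e⟩ := hl.exists_value_eq f hn hE hc1 hcomm x
    have hz : toLex (k, g) = toLex ((lev x : ℤ), (⟨g', hg'⟩ : hl.infinitesimals f hn)) := by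
      apply hl.lexHom_injective f hn hc1 hcomm
      rw [← hx, e, lexHom_toLex, natCast_zsmul]
    obtain ⟨rfl, rfl⟩ := Prod.mk.inj (toLex.injective hz)
    have hxn := hl.le_n x
    rw [toLex_nonneg_iff, toLex_le_lexUnit_iff]
    constructor
    · rcases Nat.eq_zero_or_pos (lev x) with h | h
      · refine Or.inr ⟨by exact_mod_cast h, ?_⟩
        have := f.value_nonneg x
        rw [e, h, zero_nsmul, zero_add] at this
        exact this
      · exact Or.inl (by exact_mod_cast h)
    · rcases hxn.lt_or_eq with h | h
      · exact Or.inl (by exact_mod_cast h)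
      · refine Or.inr ⟨by exact_mod_cast h, ?_⟩
        have := (f.value_le x).trans_eq hnc
        rw [e, h] at this
        have h2 : g' ≤ 0 := by simpa using this
        exact h2
  · rw [toLex_nonneg_iff, toLex_le_lexUnit_iff, lexHom_toLex]
    rintro ⟨h0, h1⟩
    constructor
    · rcases h0 with hk | ⟨rfl, hg⟩
      · rw [← neg_le_iff_add_nonneg]
        exact small _ (neg_mem g.2) k hk
      · rw [zero_zsmul, zero_add]
        exact hg
    · refine le_of_le_of_eq ?_ hnc.symm
      rcases h1 with hk | ⟨rfl, hg⟩
      · have := add_le_add_right (small g g.2 (n - k) (by omega)) (k • f.value c)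
        rwa [← add_zsmul, add_sub_cancel, natCast_zsmul] at this
      · rw [natCast_zsmul]
        have hg' : (g : H) ≤ 0 := hg
        exact add_le_of_nonpos_right hg'

end Central

/-- Positive infinitesimals are exactly the values of level-`0` elements. Their sums exist in `E`,
and a refinement there stays at level `0`. -/
theorem rdp1_infinitesimals (hn : 1 ≤ n) (hE : RDP1 E) :
    PoGroup.RDP1 (hl.infinitesimals f hn) := by
  rintro ⟨a₁, ha₁⟩ ⟨a₂, ha₂⟩ ⟨b₁, hb₁⟩ ⟨b₂, hb₂⟩ na₁ na₂ nb₁ nb₂ h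
  obtain ⟨x₁, lx₁, rfl⟩ := hl.exists_value_of_mem_infinitesimals f hn ha₁ na₁
  obtain ⟨x₂, lx₂, rfl⟩ := hl.exists_value_of_mem_infinitesimals f hn ha₂ na₂
  obtain ⟨y₁, ly₁, rfl⟩ := hl.exists_value_of_mem_infinitesimals f hn hb₁ nb₁
  obtain ⟨y₂, ly₂, rfl⟩ := hl.exists_value_of_mem_infinitesimals f hn hb₂ nb₂
  have h' : f.value x₁ + f.value x₂ = f.value y₁ + f.value y₂ := congrArg Subtype.val h
  obtain ⟨s, -, hsv, hs⟩ := hl.exists_infinitesimal_add f hn lx₁ lx₂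
  obtain ⟨c₁₁, c₁₂, c₂₁, c₂₂, e1, e2, e3, e4, hc⟩ := hE _ _ _ _ _ hs
    (f.mem_padd_iff.2 (hsv.trans h'))
  have l1 := hl.add e1
  have l2 := hl.add e2
  refine ⟨⟨_, hl.value_mem_infinitesimals f hn (a := c₁₁) (by omega)⟩,
    ⟨_, hl.value_mem_infinitesimals f hn (a := c₁₂) (by omega)⟩,
    ⟨_, hl.value_mem_infinitesimals f hn (a := c₂₁) (by omega)⟩,
    ⟨_, hl.value_mem_infinitesimals f hn (a := c₂₂) (by omega)⟩, f.value_nonneg _,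
    f.value_nonneg _, f.value_nonneg _, f.value_nonneg _, Subtype.ext (f.mem_padd_iff.1 e1),
    Subtype.ext (f.mem_padd_iff.1 e2), Subtype.ext (f.mem_padd_iff.1 e3),
    Subtype.ext (f.mem_padd_iff.1 e4), ?_⟩
  rintro ⟨x, hx⟩ ⟨y, hy⟩ x0 x1 y0 y1
  obtain ⟨x, -, rfl⟩ := hl.exists_value_of_mem_infinitesimals f hn hx x0
  obtain ⟨y, -, rfl⟩ := hl.exists_value_of_mem_infinitesimals f hn hy y0
  obtain ⟨t, t1, t2⟩ := hc x y (f.le_iff.2 x1) (f.le_iff.2 y1)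
  exact Subtype.ext ((f.mem_padd_iff.1 t1).symm.trans (f.mem_padd_iff.1 t2))

theorem directed_infinitesimals (hn : 1 ≤ n) : Directed (hl.infinitesimals f hn) := by
  rintro ⟨g, hg⟩ ⟨h, hh⟩
  obtain ⟨a, ha, hga⟩ := hl.exists_le_value f hn hg
  obtain ⟨b, hb, hhb⟩ := hl.exists_le_value f hn hh
  exact ⟨⟨f.value a + f.value b, add_mem (hl.value_mem_infinitesimals f hn ha)
    (hl.value_mem_infinitesimals f hn hb)⟩, hga.trans (le_add_of_nonneg_right (f.value_nonneg b)),
    hhb.trans (le_add_of_nonneg_left (f.value_nonneg a))⟩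

end IsLevel

instance addLeftMono_addSubgroup {H : Type*} [AddGroup H] [PartialOrder H] [AddLeftMono H]
    (G : AddSubgroup H) : AddLeftMono G where
  elim c _ _ h := add_le_add_right (α := H) h c

instance addRightMono_addSubgroup {H : Type*} [AddGroup H] [PartialOrder H] [AddRightMono H]
    (G : AddSubgroup H) : AddRightMono G where
  elim c _ _ h := add_le_add_left (α := H) h c

theorem IsStrongPerfect.exists_isRepresentedBy {n : ℕ} (hn : 1 ≤ n) {E : Type u}
    [PseudoEffectAlgebra E] (h : IsStrongPerfect n E) :
    ∃ (G : Type u) (_ : AddGroup G) (_ : PartialOrder G) (_ : AddLeftMono G)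
      (_ : AddRightMono G), IsRepresentedBy n E G := by
  obtain ⟨hE, D, hD, H, _, _, _, _, u, hu, f, htf, k, c, hk, hck, hnc, hcomm⟩ := h
  obtain ⟨lev, hl, hlD⟩ := hD.exists_isLevel
    (f.mem_padd_iff.2 (by rw [f.value_zero, add_zero]))
    (f.mem_padd_iff.2 (by rw [f.value_zero, add_zero]))
  have hc1 : lev c = 1 := ((hlD c k).1 hck).trans hk
  have hcomm' : ∀ x : H, AddCommute (f.value c) x := fun x => (hcomm x).symm
  have hu' : u = n • f.value c := f.value_one.symm.trans (f.value_of_mem_pmul hnc)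
  have hdir := hl.directed_infinitesimals f hn
  refine ⟨hl.infinitesimals f hn, inferInstance, inferInstance, inferInstance, inferInstance,
    ?_, hdir, (hl.rdp1_infinitesimals f hn hE).lex hdir, ?_⟩
  · intro g m hg hm h
    exact htf g m (fun h0 => hg (Subtype.ext h0)) hm (congrArg Subtype.val h)
  · refine f.nonempty_of_addMonoidHom _ (hl.lexHom f hn hcomm')
      (hl.lexHom_injective f hn hc1 hcomm') ?_
      (hl.lexHom_mem_interval_iff f hn hE hc1 hcomm' hu') fun x => ?_
    · rw [lexUnit, IsLevel.lexHom_toLex, natCast_zsmul]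
      exact (add_zero _).trans hu'.symm
    · obtain ⟨g, hg, e⟩ := hl.exists_value_eq f hn hE hc1 hcomm' x
      exact ⟨toLex ((lev x : ℤ), ⟨g, hg⟩), by rw [IsLevel.lexHom_toLex, natCast_zsmul, e]⟩

end PseudoEffectAlgebra

theorem theorem6p7 (E : Type u) [PseudoEffectAlgebra E] (n : ℕ) (hn : 1 ≤ n) :
    (PseudoEffectAlgebra.IsStrongPerfect n E ↔
      ∃ (G : Type u) (_ : AddGroup G) (_ : PartialOrder G) (_ : AddLeftMono G)
        (_ : AddRightMono G), PseudoEffectAlgebra.IsRepresentedBy n E G) ∧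
    (∀ (G G' : Type u)
      [AddGroup G] [PartialOrder G] [AddLeftMono G] [AddRightMono G]
      [AddGroup G'] [PartialOrder G'] [AddLeftMono G'] [AddRightMono G'],
      PseudoEffectAlgebra.IsRepresentedBy n E G →
      PseudoEffectAlgebra.IsRepresentedBy n E G' → Nonempty (G ≃+o G')) ∧
    (∀ (G : Type u) [AddGroup G] [PartialOrder G] [AddLeftMono G] [AddRightMono G],
      PseudoEffectAlgebra.IsRepresentedBy n E G → PoGroup.RDP1 G) := by
  refine ⟨⟨fun h => h.exists_isRepresentedBy hn, ?_⟩, ?_, fun G _ _ _ _ h => h.rdp1_lex.of_lex⟩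
  · rintro ⟨G, _, _, _, _, h⟩
    exact h.isStrongPerfect hn
  · intro G G' _ _ _ _ _ _ _ _ h h'
    obtain ⟨f⟩ := h.iso
    obtain ⟨f'⟩ := h'.iso
    exact PseudoEffectAlgebra.nonempty_orderAddMonoidIso_of_lex hn h.directed h'.directed f f'
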